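/- The following four properties of a finite group are qualitatively equivalent. For a finite group $G$ of order $n$ and a real constant $c>0$, consider: (a) $G$ has a product-free subset (one containing no elements $x,y,z$, not necessarily distinct, with $xy=z$) of size at least $cn$; (b) there are three subsets $A,B,C$ of $G$, each of size at least $cn$, such that $G\neq ABC$, where $ABC=\{xyz : x\in A,\ y\in B,\ z\in C\}$; (c) $G$ has a non-perfect subgroup (one that is not equal to its own derived subgroup) of index at most $1/c$; (d) $G$ is not $1/c$-quasirandom, where, for real $d$, $G$ is called $d$-quasirandom if every non-trivial unitary representation of $G$ (one in which some element of $G$ does not act as the identity) has dimension at least $d$. Then for every $c>0$ there are constants $c_1,c_2,c_3,c_4\in(0,1]$, depending only on $c$, such that every finite group $G$ which satisfies at least one of (a), (b), (c), (d) with the constant $c$ satisfies (a) with $c_1$, (b) with $c_2$, (c) with $c_3$ and (d) with $c_4$ in place of $c$. -/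

import Mathlib

open scoped Pointwise

/-- A subset `A` of a group is product-free if it contains no three (not necessarily distinct)
elements `x, y, z` with `x * y = z`. -/
def IsProductFree {G : Type*} [Group G] (A : Set G) : Prop :=
  ∀ x ∈ A, ∀ y ∈ A, ∀ z ∈ A, x * y ≠ z

/-- `G` is `d`-quasirandom: every non-trivial unitary representation of `G` has dimension at
least `d`. Only finite-dimensional representations, written in an orthonormal basis as
homomorphisms to `U(m)`, matter: infinite-dimensional ones satisfy the bound for every real `d`. -/
def IsQuasirandom (G : Type*) [Group G] (d : ℝ) : Prop :=
  ∀ (m : ℕ) (ρ : G →* Matrix.unitaryGroup (Fin m) ℂ), ρ ≠ 1 → d ≤ (m : ℝ)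

/-- There is a product-free subset of `G` of size at least `c * |G|`. -/
def HasLargeProductFree (G : Type*) [Group G] (c : ℝ) : Prop :=
  ∃ A : Set G, IsProductFree A ∧ c * (Nat.card G : ℝ) ≤ (A.ncard : ℝ)

/-- There are subsets `A, B, C` of `G`, each of size at least `c * |G|`, with `G ≠ ABC`. -/
def HasLargeDeficientTriple (G : Type*) [Group G] (c : ℝ) : Prop :=
  ∃ A B C : Set G,
    c * (Nat.card G : ℝ) ≤ (A.ncard : ℝ) ∧ c * (Nat.card G : ℝ) ≤ (B.ncard : ℝ) ∧
    c * (Nat.card G : ℝ) ≤ (C.ncard : ℝ) ∧ A * B * C ≠ Set.univ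

/-- There is a non-perfect subgroup of `G` of index at most `1 / c`. -/
def HasSmallIndexNonPerfect (G : Type*) [Group G] (c : ℝ) : Prop :=
  ∃ H : Subgroup G, ¬ Group.IsPerfect H ∧ (H.index : ℝ) ≤ 1 / c

/-! The properties form a cycle (c) ⇒ (a) ⇒ (b) ⇒ (d) ⇒ (c), each arrow losing a controlled amount
in the constant. (c) ⇒ (a): a non-perfect group maps onto a nontrivial cyclic group, whose middle
third is product-free; its preimage in the subgroup stays product-free in `G`. (a) ⇒ (b): the triple
`A, A, A⁻¹` misses `1`. (b) ⇒ (d) is Gowers' argument (`IsQuasirandom.mul_ncard_le_of_disjoint`):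
without small representations, every singular value of a convolution operator on sum-zero functions
has high multiplicity, so the operator norm is small, and `AB` cannot avoid a large set. (d) ⇒ (c)
is a weak Jordan theorem (`exists_index_bound_unitary`): in a finite unitary group, the elements
near `1` generate a subgroup of bounded index, and commutators with them shrink, which rules out
perfectness. -/

theorem HasLargeProductFree.mono {G : Type*} [Group G] {c d : ℝ} (h : HasLargeProductFree G c)
    (hd : d ≤ c) : HasLargeProductFree G d := by
  obtain ⟨A, hA, hc⟩ := h
  exact ⟨A, hA, le_trans (by gcongr) hc⟩

theorem HasLargeProductFree.hasLargeDeficientTriple {G : Type*} [Group G] {c : ℝ}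
    (h : HasLargeProductFree G c) : HasLargeDeficientTriple G c := by
  obtain ⟨A, hA, hc⟩ := h
  refine ⟨A, A, A⁻¹, hc, hc, by rwa [Set.ncard_inv], fun hu ↦ ?_⟩
  obtain ⟨y, ⟨a, ha, b, hb, rfl⟩, z, hz, h1⟩ := hu.symm ▸ Set.mem_univ (1 : G)
  exact hA a ha b hb z⁻¹ hz (eq_inv_of_mul_eq_one_left h1)

/-! ### Product-free sets from cyclic quotients -/

/-- The middle third of the residues modulo `m`. -/
def zmodMiddleThird (m : ℕ) : Set (ZMod m) := {k | m ≤ 3 * k.val ∧ 3 * k.val < 2 * m}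

theorem zmodMiddleThird_add_ne {m : ℕ} [NeZero m] {x y z : ZMod m} (hx : x ∈ zmodMiddleThird m)
    (hy : y ∈ zmodMiddleThird m) (hz : z ∈ zmodMiddleThird m) : x + y ≠ z := by
  rintro rfl
  simp only [zmodMiddleThird, Set.mem_ofPred_eq, ZMod.val_add] at hx hy hz
  rcases lt_or_ge (x.val + y.val) m with h | h
  · rw [Nat.mod_eq_of_lt h] at hz
    omega
  · rw [Nat.mod_eq_sub_mod h, Nat.mod_eq_of_lt (by omega)] at hz
    omega

/-- The density tends to 1/3; the constant 1/4 is forced by `m = 4`, where only the residue 2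
qualifies. -/
theorem le_four_mul_ncard_zmodMiddleThird {m : ℕ} (hm : 2 ≤ m) :
    m ≤ 4 * (zmodMiddleThird m).ncard := by
  have : NeZero m := ⟨by omega⟩
  have hval : ∀ k ∈ Set.Ico ((m + 2) / 3) ((2 * m + 2) / 3), ((k : ℕ) : ZMod m).val = k :=
    fun k hk ↦ ZMod.val_natCast_of_lt (by have := hk.2; omega)
  have h := Set.ncard_le_ncard_of_injOn (s := Set.Ico ((m + 2) / 3) ((2 * m + 2) / 3))
    (t := zmodMiddleThird m) (fun k : ℕ ↦ (k : ZMod m))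
    (fun k hk ↦ by
      have h1 := hk.1
      have h2 := hk.2
      simp only [zmodMiddleThird, Set.mem_ofPred_eq, hval k hk]
      omega)
    (fun k hk l hl hkl ↦ by
      rw [← hval k hk, ← hval l hl]
      exact congrArg ZMod.val hkl)
  rw [← Finset.coe_Ico, Set.ncard_coe_finset, Nat.card_Ico] at h
  rcases lt_or_ge m 8 with h8 | h8
  · interval_cases m <;> omega
  · omega

/-- A finite group that is not perfect has a nontrivial cyclic quotient. -/
theorem exists_isCyclic_quotient_of_not_isPerfect {H : Type*} [Group H] [Finite H]
    (h : ¬ Group.IsPerfect H) :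
    ∃ N : Subgroup H, ∃ _ : N.Normal, IsCyclic (H ⧸ N) ∧ Nontrivial (H ⧸ N) := by
  have : ∃ a : Abelianization H, a ≠ 1 := by
    by_contra! h1
    refine h ⟨(Subgroup.eq_top_iff' _).2 fun x ↦ ?_⟩
    rw [← Abelianization.ker_of]
    exact h1 _
  obtain ⟨a, ha⟩ := this
  have : NeZero (Monoid.exponent (Abelianization H)) :=
    ⟨Monoid.exponent_ne_zero_of_finite⟩
  obtain ⟨χ, hχ⟩ := CommGroup.exists_apply_ne_one_of_hasEnoughRootsOfUnity
    (Abelianization H) ℂ ha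
  let ψ : H →* ℂˣ := χ.comp Abelianization.of
  refine ⟨ψ.ker, inferInstance, ?_, ?_⟩
  -- A finite subgroup of the multiplicative group of a field is cyclic.
  · have : Finite ψ.range := Set.finite_range ψ
    exact (QuotientGroup.quotientKerEquivRange ψ).isCyclic.2 inferInstance
  · obtain ⟨x, rfl⟩ := QuotientGroup.mk_surjective a
    refine ⟨QuotientGroup.mk x, 1, fun hx ↦ hχ ?_⟩
    exact (QuotientGroup.eq_one_iff x).1 hx

theorem hasLargeProductFree_of_not_isPerfect {H : Type*} [Group H] [Finite H]
    (h : ¬ Group.IsPerfect H) : HasLargeProductFree H (1 / 4) := by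
  obtain ⟨N, hN, hcyc, hnt⟩ := exists_isCyclic_quotient_of_not_isPerfect h
  let e := zmodCyclicMulEquiv hcyc
  set m := Nat.card (H ⧸ N) with hm
  have hm2 : 2 ≤ m := Finite.one_lt_card
  have : NeZero m := ⟨by omega⟩
  let S : Set (H ⧸ N) := (fun q ↦ (e.symm q).toAdd) ⁻¹' zmodMiddleThird m
  have hS : S.ncard = (zmodMiddleThird m).ncard := by
    refine Set.ncard_preimage_of_injective_subset_range
      (fun x y hxy ↦ e.symm.injective (Multiplicative.toAdd.injective hxy)) fun k _ ↦
      ⟨e (Multiplicative.ofAdd k), by simp⟩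
  refine ⟨QuotientGroup.mk ⁻¹' S, fun x hx y hy z hz hxyz ↦ ?_, ?_⟩
  · refine zmodMiddleThird_add_ne hx hy hz ?_
    rw [← hxyz, ← toAdd_mul, ← map_mul]
    rfl
  · have h1 : (QuotientGroup.mk ⁻¹' S : Set H).ncard = Nat.card N * S.ncard :=
      QuotientGroup.card_preimage_mk N S
    have h2 : Nat.card H = m * Nat.card N := Subgroup.card_eq_card_quotient_mul_card_subgroup N
    have h3 := le_four_mul_ncard_zmodMiddleThird hm2
    rw [h1, h2, hS]
    have h4 : (m : ℝ) ≤ 4 * ((zmodMiddleThird m).ncard : ℝ) := by exact_mod_cast h3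
    push_cast
    nlinarith [(Nat.cast_nonneg (Nat.card N) : (0 : ℝ) ≤ _)]

theorem HasLargeProductFree.of_subgroup {G : Type*} [Group G] [Finite G] {H : Subgroup G} {c : ℝ}
    (h : HasLargeProductFree H c) : HasLargeProductFree G (c / H.index) := by
  obtain ⟨A, hA, hcard⟩ := h
  refine ⟨(↑) '' A, ?_, ?_⟩
  · rintro _ ⟨x, hx, rfl⟩ _ ⟨y, hy, rfl⟩ _ ⟨z, hz, rfl⟩ hxyz
    exact hA x hx y hy z hz (Subtype.ext hxyz)
  · rw [Set.ncard_image_of_injective _ Subtype.val_injective, ← H.card_mul_index]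
    have : (H.index : ℝ) ≠ 0 := by exact_mod_cast H.index_ne_zero_of_finite
    push_cast
    convert hcard using 1
    field_simp

theorem HasSmallIndexNonPerfect.hasLargeProductFree {G : Type*} [Group G] [Finite G] {c : ℝ}
    (hc : 0 < c) (h : HasSmallIndexNonPerfect G c) : HasLargeProductFree G (c / 4) := by
  obtain ⟨H, hH, hi⟩ := h
  refine (HasLargeProductFree.of_subgroup
    (hasLargeProductFree_of_not_isPerfect hH)).mono ?_
  have : (0 : ℝ) < H.index := by exact_mod_cast Nat.pos_of_ne_zero H.index_ne_zero_of_finite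
  rw [le_div_iff₀ hc] at hi
  rw [le_div_iff₀ this]
  linarith

/-! ### Weak Jordan theorem: small representations give non-perfect subgroups -/

section jordan

open scoped commutatorElement

theorem Group.not_isPerfect_of_isMulCommutative {G : Type*} [Group G] [Nontrivial G]
    [IsMulCommutative G] : ¬ Group.IsPerfect G := fun _ ↦
  Group.IsPerfect.not_isMulCommutative (G := G) inferInstance

/-- A group with a noncentral element all of whose commutators are central is not perfect. -/
theorem Group.not_isPerfect_of_commutatorElement_mem_center {G : Type*} [Group G] {g : G}
    (hg : g ∉ Subgroup.center G) (h : ∀ x, ⁅g, x⁆ ∈ Subgroup.center G) :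
    ¬ Group.IsPerfect G := by
  intro hp
  -- Centrality of the commutators makes `x ↦ ⁅g, x⁆` a homomorphism; its image is abelian, and
  -- nontrivial because `g` is not central.
  let φ : G →* Subgroup.center G := MonoidHom.mk' (fun x ↦ ⟨⁅g, x⁆, h x⟩) fun x y ↦ by
    apply Subtype.ext
    have h1 := Subgroup.mem_center_iff.1 (h y) x
    calc ⁅g, x * y⁆ = ⁅g, x⁆ * (x * ⁅g, y⁆ * x⁻¹) := by simp only [commutatorElement_def]; group
      _ = ⁅g, x⁆ * ⁅g, y⁆ := by rw [h1]; group
  have hr : φ.range ≠ ⊥ := by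
    intro hbot
    refine hg (Subgroup.mem_center_iff.2 fun x ↦ ?_)
    have h2 : φ x ∈ φ.range := ⟨x, rfl⟩
    rw [hbot, Subgroup.mem_bot] at h2
    exact (commutatorElement_eq_one_iff_mul_comm.1 (congrArg Subtype.val h2)).symm
  have : Nontrivial φ.range := (Subgroup.nontrivial_iff_ne_bot _).2 hr
  exact Group.not_isPerfect_of_isMulCommutative (G := φ.range) (Group.IsPerfect.range φ)

/-- A nontrivial finite group carrying a "size" function under which commutation with a set of
generators shrinks the size is not perfect. -/
theorem Group.not_isPerfect_of_commutator_shrinks {G : Type*} [Group G] [Finite G] [Nontrivial G]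
    {S : Set G} (hS : Subgroup.closure S = ⊤) (ν : G → ℝ)
    (hν : ∀ g, g ≠ 1 → ∀ s ∈ S, ν ⁅g, s⁆ < ν g) : ¬ Group.IsPerfect G := by
  by_cases hc : ∀ g : G, g ∈ Subgroup.center G
  · have : IsMulCommutative G := ⟨⟨fun x y ↦ Subgroup.mem_center_iff.1 (hc y) x⟩⟩
    exact Group.not_isPerfect_of_isMulCommutative
  push Not at hc
  -- For a smallest noncentral `g`, commutators with generators are smaller, hence central; this
  -- extends to the whole group.
  obtain ⟨g, hg, hmin⟩ := Set.exists_min_image {g : G | g ∉ Subgroup.center G} ν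
    (Set.toFinite _) hc
  refine Group.not_isPerfect_of_commutatorElement_mem_center hg fun x ↦ ?_
  have hx : x ∈ Subgroup.closure S := hS ▸ Subgroup.mem_top x
  have hg1 : g ≠ 1 := fun h ↦ hg (h ▸ Subgroup.one_mem _)
  induction hx using Subgroup.closure_induction with
  | mem s hs =>
    by_contra hn
    exact absurd (hmin _ hn) (not_le.2 (hν g hg1 s hs))
  | one => simp
  | mul x y _ _ hx hy =>
    have h1 := Subgroup.mem_center_iff.1 hy x
    have : ⁅g, x * y⁆ = ⁅g, x⁆ * ⁅g, y⁆ := by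
      calc ⁅g, x * y⁆ = ⁅g, x⁆ * (x * ⁅g, y⁆ * x⁻¹) := by simp only [commutatorElement_def]; group
        _ = ⁅g, x⁆ * ⁅g, y⁆ := by rw [h1]; group
    exact this ▸ mul_mem hx hy
  | inv x _ hx =>
    have h1 := Subgroup.mem_center_iff.1 (inv_mem hx) x⁻¹
    have : ⁅g, x⁻¹⁆ = ⁅g, x⁆⁻¹ := by
      calc ⁅g, x⁻¹⁆ = x⁻¹ * ⁅g, x⁆⁻¹ * x := by simp only [commutatorElement_def]; group
        _ = ⁅g, x⁆⁻¹ := by rw [h1]; group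
    exact this ▸ inv_mem hx

theorem not_isPerfect_of_surjective {G K : Type*} [Group G] [Group K] {f : G →* K}
    (hf : Function.Surjective f) (h : ¬ Group.IsPerfect K) : ¬ Group.IsPerfect G := fun _ ↦
  h (Group.IsPerfect.ofSurjective hf)

section unitary
open scoped Matrix.Norms.L2Operator

/-- Multiplying by the unitary `h * g` preserves the norm and leaves `gh - hg = (g - 1)(h - 1) - (h
- 1)(g - 1)`. -/
theorem norm_coe_commutatorElement_sub_one_le {m : ℕ} (g h : Matrix.unitaryGroup (Fin m) ℂ) :
    ‖((⁅g, h⁆ : Matrix.unitaryGroup (Fin m) ℂ) : Matrix (Fin m) (Fin m) ℂ) - 1‖ ≤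
      2 * ‖(g : Matrix (Fin m) (Fin m) ℂ) - 1‖ * ‖(h : Matrix (Fin m) (Fin m) ℂ) - 1‖ := by
  have h1 : ‖((⁅g, h⁆ : Matrix.unitaryGroup (Fin m) ℂ) : Matrix (Fin m) (Fin m) ℂ) - 1‖ =
      ‖(g * h : Matrix (Fin m) (Fin m) ℂ) - h * g‖ := by
    rw [← CStarRing.norm_mul_coe_unitary _ (h * g)]
    congr 1
    rw [sub_mul, one_mul, ← Submonoid.coe_mul, commutatorElement_def]
    have : g * h * g⁻¹ * h⁻¹ * (h * g) = g * h := by group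
    rw [this]; rfl
  have h2 : (g * h : Matrix (Fin m) (Fin m) ℂ) - h * g =
      ((g : Matrix (Fin m) (Fin m) ℂ) - 1) * (h - 1) - (h - 1) * (g - 1) := by noncomm_ring
  rw [h1, h2]
  refine (norm_sub_le _ _).trans ?_
  have h3 := norm_mul_le ((g : Matrix (Fin m) (Fin m) ℂ) - 1) (h - 1)
  have h4 := norm_mul_le ((h : Matrix (Fin m) (Fin m) ℂ) - 1) (g - 1)
  linarith

theorem norm_coe_inv_mul_sub_one {m : ℕ} (u v : Matrix.unitaryGroup (Fin m) ℂ) :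
    ‖((u⁻¹ * v : Matrix.unitaryGroup (Fin m) ℂ) : Matrix (Fin m) (Fin m) ℂ) - 1‖ =
      ‖(v : Matrix (Fin m) (Fin m) ℂ) - u‖ := by
  rw [← CStarRing.norm_coe_unitary_mul u, mul_sub, mul_one, ← Submonoid.coe_mul,
    mul_inv_cancel_left]

/-- The size of a `1 / 2`-separated subset of the unitary group is bounded. -/
theorem exists_card_bound_of_separated (m : ℕ) : ∃ N : ℕ, 0 < N ∧ ∀ (ι : Type) [Finite ι]
    (u : ι → Matrix.unitaryGroup (Fin m) ℂ),
    (∀ i j, i ≠ j → (1 / 2 : ℝ) ≤ ‖(u i : Matrix (Fin m) (Fin m) ℂ) - u j‖) →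
    Nat.card ι ≤ N := by
  have hprop : ProperSpace (Matrix (Fin m) (Fin m) ℂ) := FiniteDimensional.proper ℂ _
  -- Compactness of the unit ball: each ball of radius 1/4 in a finite cover holds at most one point
  -- of a 1/2-separated family.
  obtain ⟨t, -, ht, hcov⟩ := (isCompact_closedBall (0 : Matrix (Fin m) (Fin m) ℂ) 1).finite_cover_balls
    (by norm_num : (0 : ℝ) < 1 / 4)
  have hmem : ∀ u : Matrix.unitaryGroup (Fin m) ℂ, ∃ x : t,
      ‖(u : Matrix (Fin m) (Fin m) ℂ) - x‖ < 1 / 4 := by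
    intro u
    have hu : (u : Matrix (Fin m) (Fin m) ℂ) ∈ Metric.closedBall (0 : Matrix (Fin m) (Fin m) ℂ) 1 := by
      rw [mem_closedBall_zero_iff]
      rcases subsingleton_or_nontrivial (Matrix (Fin m) (Fin m) ℂ) with hs | hs
      · rw [Subsingleton.elim (u : Matrix (Fin m) (Fin m) ℂ) 0, norm_zero]; norm_num
      · exact (CStarRing.norm_of_mem_unitary u.2).le
    have := hcov hu
    simp only [Set.mem_iUnion, Metric.mem_ball, dist_eq_norm] at this
    obtain ⟨x, hx, hlt⟩ := this
    exact ⟨⟨x, hx⟩, hlt⟩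
  choose f hf using hmem
  have : Finite t := ht
  refine ⟨Nat.card t + 1, by omega, fun ι _ u hu ↦ ?_⟩
  refine (Nat.card_le_card_of_injective (fun i ↦ f (u i)) fun i j hij ↦ ?_).trans (Nat.le_succ _)
  by_contra hne
  have h1 := hu i j hne
  have h2 := hf (u i)
  have h3 := hf (u j)
  simp only at hij
  rw [hij] at h2
  have h4 := norm_sub_le ((u i : Matrix (Fin m) (Fin m) ℂ) - f (u j)) (u j - f (u j))
  rw [sub_sub_sub_cancel_right] at h4
  linarith

/-- A weak form of Jordan's theorem: nontrivial finite subgroups of `U(m)` have non-perfect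
subgroups of bounded index. -/
theorem exists_index_bound_unitary (m : ℕ) : ∃ N : ℕ, 0 < N ∧
    ∀ (K : Subgroup (Matrix.unitaryGroup (Fin m) ℂ)) [Finite K], K ≠ ⊥ →
      ∃ H : Subgroup K, ¬ Group.IsPerfect H ∧ H.index ≤ N := by
  obtain ⟨N, hN0, hN⟩ := exists_card_bound_of_separated m
  refine ⟨N, hN0, fun K _ hK ↦ ?_⟩
  let U := Matrix.unitaryGroup (Fin m) ℂ
  let ν : K → ℝ := fun g ↦ ‖((g : U) : Matrix (Fin m) (Fin m) ℂ) - 1‖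
  -- The radius 1/2 cancels the factor 2 in the commutator estimate. Representatives of distinct
  -- cosets of the closure are 1/2-separated, which bounds the index.
  let S : Set K := {g | ν g < 1 / 2}
  have hindex : (Subgroup.closure S).index ≤ N := by
    obtain ⟨n, ⟨e⟩⟩ := Finite.exists_equiv_fin (K ⧸ Subgroup.closure S)
    rw [Subgroup.index, Nat.card_congr e]
    refine hN (Fin n) (fun i ↦ ((e.symm i).out : K)) fun i j hij ↦ ?_
    by_contra hlt
    push Not at hlt
    refine hij (e.symm.injective ?_)
    rw [← QuotientGroup.out_eq' (e.symm i), ← QuotientGroup.out_eq' (e.symm j), eq_comm,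
      QuotientGroup.eq]
    refine Subgroup.subset_closure ?_
    generalize ((e.symm i).out : K) = a at hlt ⊢
    generalize ((e.symm j).out : K) = b at hlt ⊢
    exact (norm_coe_inv_mul_sub_one b.1 a.1).trans_lt hlt
  by_cases hbot : Subgroup.closure S = ⊥
  -- Here `K` itself has order at most `N`, so any nontrivial cyclic subgroup serves.
  · have : Nontrivial K := (Subgroup.nontrivial_iff_ne_bot _).2 hK
    obtain ⟨g, hg⟩ := exists_ne (1 : K)
    have : Nontrivial (Subgroup.zpowers g) :=
      (Subgroup.nontrivial_iff_ne_bot _).2 (by rwa [Ne, Subgroup.zpowers_eq_bot])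
    refine ⟨Subgroup.zpowers g, Group.not_isPerfect_of_isMulCommutative, ?_⟩
    exact (Subgroup.index_antitone (hbot ▸ bot_le)).trans hindex
  · have : Nontrivial (Subgroup.closure S) := (Subgroup.nontrivial_iff_ne_bot _).2 hbot
    refine ⟨Subgroup.closure S, Group.not_isPerfect_of_commutator_shrinks
      (Subgroup.closure_closure_coe_preimage (k := S)) (fun g ↦ ν g) fun g hg s hs ↦ ?_, hindex⟩
    have h1 : ν s < 1 / 2 := hs
    have h2 : 0 < ν g := by
      refine norm_pos_iff.2 (sub_ne_zero.2 fun h ↦ hg ?_)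
      exact Subtype.ext (Subtype.ext (Subtype.ext h))
    calc ν (⁅g, s⁆ : Subgroup.closure S) ≤ 2 * ν g * ν s := norm_coe_commutatorElement_sub_one_le g.1.1 s.1.1
      _ < ν g := by nlinarith

end unitary

theorem exists_hasSmallIndexNonPerfect_of_not_isQuasirandom (d : ℝ) :
    ∃ c : ℝ, 0 < c ∧ c ≤ 1 ∧ ∀ (G : Type*) [Group G] [Finite G],
      ¬ IsQuasirandom G d → HasSmallIndexNonPerfect G c := by
  choose N hN0 hN using exists_index_bound_unitary
  -- The sum is a common bound for all dimensions up to `⌈d⌉₊`.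
  let M := ∑ m ∈ Finset.range (⌈d⌉₊ + 1), N m
  have hle : ∀ m ≤ ⌈d⌉₊, N m ≤ M := fun m hm ↦
    Finset.single_le_sum (f := N) (fun _ _ ↦ Nat.zero_le _) (Finset.mem_range.2 (by omega))
  have hM : (1 : ℝ) ≤ M := by exact_mod_cast (hN0 0).trans_le (hle 0 (Nat.zero_le _))
  refine ⟨1 / M, by positivity, by rw [div_le_one] <;> linarith, fun G _ _ hG ↦ ?_⟩
  simp only [IsQuasirandom, not_forall, not_le] at hG
  obtain ⟨m, ρ, hρ, hm⟩ := hG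
  have hmd : m ≤ ⌈d⌉₊ := by exact_mod_cast hm.le.trans (Nat.le_ceil d)
  have : Finite ρ.range := Set.finite_range ρ
  obtain ⟨H, hH, hi⟩ := hN m ρ.range (by rwa [Ne, MonoidHom.range_eq_bot_iff])
  refine ⟨H.comap ρ.rangeRestrict, ?_, ?_⟩
  · refine not_isPerfect_of_surjective (f := ρ.rangeRestrict.subgroupComap H) ?_ hH
    exact MonoidHom.subgroupComap_surjective_of_surjective _ _ ρ.rangeRestrict_surjective
  · rw [Subgroup.index_comap_of_surjective _ ρ.rangeRestrict_surjective, one_div_one_div]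
    exact_mod_cast hi.trans (hle m hmd)

end jordan

/-! ### Gowers' mixing estimate for quasirandom groups -/

section gowers
open scoped InnerProductSpace
open Module

/-- A subspace invariant under a representation, as a representation. -/
def restrictRepresentation {G E : Type*} [Group G] [AddCommGroup E] [Module ℂ E]
    (ρ : Representation ℂ G E) (W : Submodule ℂ E) (hW : ∀ g, ∀ w ∈ W, ρ g w ∈ W) :
    Representation ℂ G W where
  toFun g := (ρ g).restrict (hW g)
  map_one' := by ext; simp
  map_mul' g h := by ext; simp

theorem IsQuasirandom.le_finrank {G : Type*} [Group G] {d : ℝ} (hG : IsQuasirandom G d)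
    {W : Type*} [NormedAddCommGroup W] [InnerProductSpace ℂ W] [FiniteDimensional ℂ W]
    (ρ : Representation ℂ G W) (hρ : ∀ g x y, ⟪ρ g x, ρ g y⟫_ℂ = ⟪x, y⟫_ℂ) (hne : ρ ≠ 1) :
    d ≤ finrank ℂ W := by
  let Φ := LinearMap.toMatrixOrthonormal (stdOrthonormalBasis ℂ W)
  have hmem : ∀ g, Φ (ρ g) ∈ Matrix.unitaryGroup (Fin (finrank ℂ W)) ℂ := by
    intro g
    have hadj : star (ρ g) * ρ g = 1 := by
      refine LinearMap.ext fun x ↦ ext_inner_left ℂ fun y ↦ ?_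
      rw [LinearMap.star_eq_adjoint, Module.End.mul_apply, LinearMap.adjoint_inner_right, hρ]
      rfl
    rw [Matrix.mem_unitaryGroup_iff', ← map_star, ← map_mul, hadj, map_one]
  let σ : G →* Matrix.unitaryGroup (Fin (finrank ℂ W)) ℂ :=
    { toFun := fun g ↦ ⟨Φ (ρ g), hmem g⟩
      map_one' := Subtype.ext (by simp)
      map_mul' := fun g h ↦ Subtype.ext (by simp) }
  refine hG _ σ fun h ↦ hne (MonoidHom.ext fun g ↦ Φ.injective ?_)
  have := congrArg Subtype.val (DFunLike.congr_fun h g)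
  rw [MonoidHom.one_apply, map_one]
  exact this

/-- The square of the norm of an operator is an eigenvalue of `T† T`. -/
theorem exists_hasEigenvalue_adjoint_comp_self {V E : Type*} [NormedAddCommGroup V]
    [InnerProductSpace ℂ V] [FiniteDimensional ℂ V] [NormedAddCommGroup E]
    [InnerProductSpace ℂ E] [FiniteDimensional ℂ E] [Nontrivial V] (T : V →ₗ[ℂ] E) :
    ∃ r : ℝ, End.HasEigenvalue (LinearMap.adjoint T ∘ₗ T) (r : ℂ) ∧
      ∀ f, ‖T f‖ ^ 2 ≤ r * ‖f‖ ^ 2 := by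
  have hS : (LinearMap.adjoint T ∘ₗ T).IsSymmetric := fun x y ↦ by
    simp [LinearMap.adjoint_inner_left, LinearMap.adjoint_inner_right]
  have hre : ∀ f, RCLike.re ⟪(LinearMap.adjoint T ∘ₗ T) f, f⟫_ℂ = ‖T f‖ ^ 2 := fun f ↦ by
    rw [LinearMap.comp_apply, LinearMap.adjoint_inner_left, inner_self_eq_norm_sq]
  refine ⟨_, hS.hasEigenvalue_iSup_of_finiteDimensional, fun f ↦ ?_⟩
  rcases eq_or_ne f 0 with rfl | hf
  · simp
  have hpos : ∀ f : V, f ≠ 0 → 0 < ‖f‖ ^ 2 := fun f hf ↦ by positivity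
  rw [← div_le_iff₀ (hpos f hf), ← hre f]
  refine le_ciSup (f := fun x : {x : V // x ≠ 0} ↦
    RCLike.re ⟪(LinearMap.adjoint T ∘ₗ T) x, x⟫_ℂ / ‖(x : V)‖ ^ 2) ?_ ⟨f, hf⟩
  refine ⟨‖LinearMap.toContinuousLinearMap T‖ ^ 2, ?_⟩
  rintro _ ⟨⟨x, hx⟩, rfl⟩
  simp only [hre]
  rw [div_le_iff₀ (hpos x hx), ← mul_pow]
  gcongr
  exact (LinearMap.toContinuousLinearMap T).le_opNorm x

/-- An intertwining operator out of a unitary representation without fixed vectors of a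
quasirandom group has small operator norm compared with its Hilbert-Schmidt norm. -/
theorem IsQuasirandom.mul_norm_sq_le {G : Type*} [Group G] {d : ℝ} (hG : IsQuasirandom G d)
    {V E : Type*} [NormedAddCommGroup V]
    [InnerProductSpace ℂ V] [FiniteDimensional ℂ V] [NormedAddCommGroup E]
    [InnerProductSpace ℂ E] [FiniteDimensional ℂ E]
    (ρ : Representation ℂ G V) (hρ : ∀ g x y, ⟪ρ g x, ρ g y⟫_ℂ = ⟪x, y⟫_ℂ)
    (σ : Representation ℂ G E) (hσ : ∀ g x y, ⟪σ g x, σ g y⟫_ℂ = ⟪x, y⟫_ℂ)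
    (hfix : ∀ v, (∀ g, ρ g v = v) → v = 0)
    (T : V →ₗ[ℂ] E) (hT : ∀ g v, T (ρ g v) = σ g (T v)) {B : ℝ}
    (hB : ∀ (n : ℕ) (e : Fin n → V), Orthonormal ℂ e → ∑ i, ‖T (e i)‖ ^ 2 ≤ B) (f : V) :
    d * ‖T f‖ ^ 2 ≤ B * ‖f‖ ^ 2 := by
  rcases eq_or_ne f 0 with rfl | hf
  · simp
  have : Nontrivial V := ⟨f, 0, hf⟩
  obtain ⟨r, hr, hle⟩ := exists_hasEigenvalue_adjoint_comp_self T
  set S := LinearMap.adjoint T ∘ₗ T with hS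
  have hcomm : ∀ g v, S (ρ g v) = ρ g (S v) := by
    intro g v
    refine ext_inner_left ℂ fun w ↦ ?_
    have hw : w = ρ g (ρ g⁻¹ w) := by
      rw [← Module.End.mul_apply, ← map_mul, mul_inv_cancel, map_one, Module.End.one_apply]
    rw [hw, hρ, hS, LinearMap.comp_apply, LinearMap.comp_apply, LinearMap.adjoint_inner_right,
      LinearMap.adjoint_inner_right, hT _ (ρ g⁻¹ w), hT g v, hσ]
  -- The top eigenspace of `T† T` is invariant and has no nonzero fixed vector, so its dimension is
  -- at least `d`; its share of the Hilbert-Schmidt norm then gives `d * r ≤ B`.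
  let W := End.eigenspace S (r : ℂ)
  have hW : ∀ g, ∀ w ∈ W, ρ g w ∈ W := fun g w hw ↦ by
    rw [End.mem_eigenspace_iff] at hw ⊢
    rw [hcomm, hw, map_smul]
  have hd : d ≤ finrank ℂ W := by
    refine hG.le_finrank (restrictRepresentation ρ W hW) (fun g x y ↦ hρ g x y) fun h1 ↦ ?_
    obtain ⟨w, hw⟩ := hr.exists_hasEigenvector
    refine hw.2 (hfix w fun g ↦ ?_)
    exact congrArg Subtype.val (LinearMap.congr_fun (DFunLike.congr_fun h1 g) ⟨w, hw.1⟩)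
  have htrace : finrank ℂ W * r ≤ B := by
    let b := stdOrthonormalBasis ℂ W
    have hb : Orthonormal ℂ fun i ↦ (b i : V) :=
      b.orthonormal.comp_linearIsometry W.subtypeₗᵢ
    refine le_trans (le_of_eq ?_) (hB _ _ hb)
    have : ∀ i, ‖T (b i)‖ ^ 2 = r := by
      intro i
      have h1 := End.mem_eigenspace_iff.1 (b i).2
      rw [← inner_self_eq_norm_sq (𝕜 := ℂ), ← LinearMap.adjoint_inner_right]
      change RCLike.re ⟪(b i : V), S (b i)⟫_ℂ = r
      rw [h1, inner_smul_right, inner_self_eq_norm_sq_to_K, hb.1 i]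
      simp
    simp [this]
  calc d * ‖T f‖ ^ 2 ≤ finrank ℂ W * (r * ‖f‖ ^ 2) := by
        gcongr
        exact hle f
    _ = (finrank ℂ W * r) * ‖f‖ ^ 2 := by ring
    _ ≤ B * ‖f‖ ^ 2 := by gcongr

/-- Version of `IsQuasirandom.mul_norm_sq_le` for the restriction of an operator to an invariant
subspace. -/
theorem IsQuasirandom.mul_norm_sq_le_of_mem {G : Type*} [Group G] {d : ℝ}
    (hG : IsQuasirandom G d) {E : Type*} [NormedAddCommGroup E]
    [InnerProductSpace ℂ E] [FiniteDimensional ℂ E]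
    (ρ : Representation ℂ G E) (hρ : ∀ g x y, ⟪ρ g x, ρ g y⟫_ℂ = ⟪x, y⟫_ℂ)
    (V : Submodule ℂ E) (hV : ∀ g, ∀ v ∈ V, ρ g v ∈ V)
    (hfix : ∀ v ∈ V, (∀ g, ρ g v = v) → v = 0)
    (T : E →ₗ[ℂ] E) (hT : ∀ g v, T (ρ g v) = ρ g (T v)) {B : ℝ}
    (hB : ∀ (n : ℕ) (e : Fin n → E), Orthonormal ℂ e → ∑ i, ‖T (e i)‖ ^ 2 ≤ B) {f : E}
    (hf : f ∈ V) : d * ‖T f‖ ^ 2 ≤ B * ‖f‖ ^ 2 :=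
  hG.mul_norm_sq_le (restrictRepresentation ρ V hV) (fun g x y ↦ hρ g x.1 y.1) ρ hρ
    (fun v hv ↦ Subtype.ext (hfix v.1 v.2 fun g ↦ congrArg Subtype.val (hv g)))
    (T ∘ₗ V.subtype) (fun g v ↦ hT g v.1)
    (fun n _ he ↦ hB n _ (he.comp_linearIsometry V.subtypeₗᵢ)) ⟨f, hf⟩

variable {G : Type*} [Group G] [Fintype G]

/-- The right regular representation on complex functions. -/
noncomputable def rightRegular (G : Type*) [Group G] [Fintype G] :
    Representation ℂ G (EuclideanSpace ℂ G) where
  toFun g :=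
    { toFun := fun f ↦ WithLp.toLp 2 fun x ↦ f (x * g)
      map_add' := fun f h ↦ by ext; simp
      map_smul' := fun c f ↦ by ext; simp }
  map_one' := by ext; simp
  map_mul' g h := by ext; simp [mul_assoc]

theorem rightRegular_apply (g : G) (f : EuclideanSpace ℂ G) (x : G) :
    rightRegular G g f x = f (x * g) := rfl

theorem inner_rightRegular (g : G) (f h : EuclideanSpace ℂ G) :
    ⟪rightRegular G g f, rightRegular G g h⟫_ℂ = ⟪f, h⟫_ℂ := by
  simp only [PiLp.inner_apply, rightRegular_apply]
  exact Fintype.sum_equiv (Equiv.mulRight g) _ _ fun _ ↦ rfl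

/-- Convolution on the left by `k`. -/
noncomputable def leftConv (k : G → ℂ) : EuclideanSpace ℂ G →ₗ[ℂ] EuclideanSpace ℂ G where
  toFun f := WithLp.toLp 2 fun x ↦ ∑ y, k (x * y⁻¹) * f y
  map_add' f h := by ext; simp [mul_add, Finset.sum_add_distrib]
  map_smul' c f := by ext; simp [Finset.mul_sum, mul_left_comm]

theorem leftConv_apply (k : G → ℂ) (f : EuclideanSpace ℂ G) (x : G) :
    leftConv k f x = ∑ y, k (x * y⁻¹) * f y := rfl

theorem leftConv_rightRegular (k : G → ℂ) (g : G) (f : EuclideanSpace ℂ G) :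
    leftConv k (rightRegular G g f) = rightRegular G g (leftConv k f) := by
  ext x
  simp only [rightRegular_apply, leftConv_apply]
  exact Fintype.sum_equiv (Equiv.mulRight g) _ _ fun y ↦ by simp [mul_assoc]

/-- A Hilbert-Schmidt bound: each row of the convolution matrix is a rearrangement of conjugated
`k`, and Bessel's inequality applies row by row. -/
theorem sum_norm_leftConv_sq_le (k : G → ℂ) {n : ℕ} {e : Fin n → EuclideanSpace ℂ G}
    (he : Orthonormal ℂ e) :
    ∑ i, ‖leftConv k (e i)‖ ^ 2 ≤ Fintype.card G * ∑ a, ‖k a‖ ^ 2 := by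
  let v : G → EuclideanSpace ℂ G := fun x ↦ WithLp.toLp 2 fun y ↦ star (k (x * y⁻¹))
  have h1 : ∀ f x, leftConv k f x = ⟪v x, f⟫_ℂ := fun f x ↦ by
    simp [leftConv_apply, PiLp.inner_apply, v, mul_comm]
  have h2 : ∀ x, ‖v x‖ ^ 2 = ∑ a, ‖k a‖ ^ 2 := fun x ↦ by
    rw [EuclideanSpace.norm_sq_eq]
    exact Fintype.sum_equiv ((Equiv.inv G).trans (Equiv.mulLeft x)) _ _ fun y ↦ by simp [v]
  calc ∑ i, ‖leftConv k (e i)‖ ^ 2 = ∑ i, ∑ x, ‖⟪v x, e i⟫_ℂ‖ ^ 2 := by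
        simp only [EuclideanSpace.norm_sq_eq, h1]
    _ = ∑ x, ∑ i, ‖⟪e i, v x⟫_ℂ‖ ^ 2 := by
        rw [Finset.sum_comm]
        simp only [norm_inner_symm]
    _ ≤ ∑ x, ‖v x‖ ^ 2 := Finset.sum_le_sum fun x _ ↦
        he.sum_inner_products_le (s := Finset.univ) (v x)
    _ = Fintype.card G * ∑ a, ‖k a‖ ^ 2 := by simp [h2]

/-- The functions of sum zero. -/
noncomputable def sumZero (G : Type*) [Fintype G] : Submodule ℂ (EuclideanSpace ℂ G) where
  carrier := {f | ∑ x, f x = 0}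
  add_mem' {f h} hf hh := by
    simp_all [Finset.sum_add_distrib]
  zero_mem' := by simp
  smul_mem' c f hf := by
    simp_all [← Finset.mul_sum]

theorem mem_sumZero {G : Type*} [Fintype G] {f : EuclideanSpace ℂ G} : f ∈ sumZero G ↔ ∑ x, f x = 0 := Iff.rfl

/-- Left convolution commutes with right translation, and a translation-invariant function is
constant, so it vanishes if its sum does. -/
theorem IsQuasirandom.mul_norm_leftConv_sq_le {d : ℝ} (hG : IsQuasirandom G d) (k : G → ℂ)
    {f : EuclideanSpace ℂ G} (hf : ∑ x, f x = 0) :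
    d * ‖leftConv k f‖ ^ 2 ≤ (Fintype.card G * ∑ a, ‖k a‖ ^ 2) * ‖f‖ ^ 2 := by
  have hinv : ∀ g, ∀ h ∈ sumZero G, rightRegular G g h ∈ sumZero G := fun g h hh ↦ by
    rw [mem_sumZero] at hh ⊢
    simp only [rightRegular_apply]
    exact (Equiv.sum_comp (Equiv.mulRight g) fun x ↦ h x).trans hh
  have hfix : ∀ v ∈ sumZero G, (∀ g, rightRegular G g v = v) → v = 0 := by
    intro v hsum hv
    have hconst : ∀ g, v g = v 1 := fun g ↦ by
      have h2 := rightRegular_apply g v 1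
      rwa [hv g, one_mul, eq_comm] at h2
    rw [mem_sumZero] at hsum
    simp only [hconst, Finset.sum_const, Finset.card_univ, nsmul_eq_mul, mul_eq_zero,
      Nat.cast_eq_zero, Fintype.card_ne_zero, false_or] at hsum
    refine PiLp.ext fun g ↦ ?_
    rw [hconst, hsum]
    rfl
  exact hG.mul_norm_sq_le_of_mem (rightRegular G) inner_rightRegular (sumZero G) hinv hfix
    (leftConv k) (leftConv_rightRegular k) (fun _ _ ↦ sum_norm_leftConv_sq_le k) hf

/-- In a quasirandom group, a product set `AB` of large sets cannot avoid a large set `X`. -/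
theorem IsQuasirandom.mul_ncard_le_of_disjoint {d : ℝ} (hG : IsQuasirandom G d) {A B X : Set G}
    (hA : A.Nonempty) (hB : B.Nonempty) (hABX : Disjoint (A * B) X) :
    d * (A.ncard * B.ncard * X.ncard) ≤ (Nat.card G : ℝ) ^ 3 := by
  classical
  have hcard : ∀ S : Set G, ∑ x, S.indicator (fun _ ↦ (1 : ℝ)) x = S.ncard := fun S ↦ by
    simp [Set.indicator_apply, Set.ncard_eq_toFinset_card', Finset.sum_boole, Set.toFinset]
  have hcardC : ∀ S : Set G, ∑ x, S.indicator (fun _ ↦ (1 : ℂ)) x = S.ncard := fun S ↦ by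
    simp [Set.indicator_apply, Set.ncard_eq_toFinset_card', Finset.sum_boole, Set.toFinset]
  rw [Nat.card_eq_fintype_card]
  set n : ℝ := (Fintype.card G : ℝ) with hn
  have hn0 : 0 < n := Nat.cast_pos.2 Fintype.card_pos
  set k : G → ℂ := A.indicator fun _ ↦ 1 with hk
  set β : ℝ := B.ncard / n with hβ
  -- Subtracting the density `β` from the indicator of `B` gives a function of sum zero.
  set f : EuclideanSpace ℂ G := WithLp.toLp 2 fun x ↦ B.indicator (fun _ ↦ 1) x - (β : ℂ) with hf
  have hfsum : ∑ x, f x = 0 := by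
    simp only [hf, Finset.sum_sub_distrib, hcardC, Finset.sum_const, Finset.card_univ,
      nsmul_eq_mul, hβ]
    have : (Fintype.card G : ℂ) ≠ 0 := by exact_mod_cast Fintype.card_ne_zero
    push_cast [hn]
    field_simp
    simp
  have hkA : ∑ a, ‖k a‖ ^ 2 = A.ncard := by
    rw [← hcard]
    refine Finset.sum_congr rfl fun a _ ↦ ?_
    by_cases ha : a ∈ A <;> simp [hk, ha]
  have hfB : ‖f‖ ^ 2 ≤ B.ncard := by
    have h1 : ∀ x, ‖f x‖ ^ 2 = (1 - 2 * β) * B.indicator (fun _ ↦ (1 : ℝ)) x + β ^ 2 := by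
      intro x
      by_cases hx : x ∈ B
      · have : f x = ((1 - β : ℝ) : ℂ) := by simp [hf, hx]
        rw [this, Complex.norm_real, Real.norm_eq_abs, sq_abs]
        simp [hx]; ring
      · have : f x = ((-β : ℝ) : ℂ) := by simp [hf, hx]
        rw [this, Complex.norm_real, Real.norm_eq_abs, sq_abs]
        simp [hx]
    rw [EuclideanSpace.norm_sq_eq]
    simp only [h1, Finset.sum_add_distrib, ← Finset.mul_sum, hcard, Finset.sum_const,
      Finset.card_univ, nsmul_eq_mul, ← hn]
    have h2 : n * β = B.ncard := by rw [hβ]; field_simp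
    have h3 : 0 ≤ β := by positivity
    have h4 : (0 : ℝ) ≤ B.ncard := by positivity
    nlinarith
  -- On `X` the convolution of the two indicators vanishes, leaving only the contribution of `-β`.
  have hconv : ∀ x ∈ X, leftConv k f x = ((-(A.ncard * β) : ℝ) : ℂ) := by
    intro x hx
    have h1 : ∀ y, k (x * y⁻¹) * f y = -(k (x * y⁻¹) * β) := by
      intro y
      by_cases hy : y ∈ B
      · have : x * y⁻¹ ∉ A := fun ha ↦ Set.disjoint_left.1 hABX
          ⟨_, ha, y, hy, inv_mul_cancel_right x y⟩ hx
        simp [hk, this]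
      · simp [hf, hy]
    have h2 : ∑ y, k (x * y⁻¹) = A.ncard := by
      rw [← hcardC]
      exact Fintype.sum_equiv ((Equiv.inv G).trans (Equiv.mulLeft x)) _ _ fun y ↦ by simp [hk]
    rw [leftConv_apply, Finset.sum_congr rfl fun y _ ↦ h1 y, Finset.sum_neg_distrib,
      ← Finset.sum_mul, h2]
    push_cast
    rfl
  have hlow : X.ncard * (A.ncard * β) ^ 2 ≤ ‖leftConv k f‖ ^ 2 := by
    rw [EuclideanSpace.norm_sq_eq, ← hcard, Finset.sum_mul]
    refine Finset.sum_le_sum fun x _ ↦ ?_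
    by_cases hx : x ∈ X
    · rw [hconv x hx, Complex.norm_real, Real.norm_eq_abs, sq_abs]
      simp [hx]
    · simp only [hx, not_false_eq_true, Set.indicator_of_notMem, zero_mul]
      positivity
  have ha : (0 : ℝ) < A.ncard := by exact_mod_cast (Set.ncard_pos).2 hA
  have hb : (0 : ℝ) < B.ncard := by exact_mod_cast (Set.ncard_pos).2 hB
  rcases le_or_gt d 0 with hd | hd
  · exact (mul_nonpos_of_nonpos_of_nonneg hd (by positivity)).trans (by positivity)
  have hmain := hG.mul_norm_leftConv_sq_le k hfsum
  rw [hkA, ← hn] at hmain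
  have h5 : d * (X.ncard * (A.ncard * β) ^ 2) ≤ n * A.ncard * B.ncard :=
    (mul_le_mul_of_nonneg_left hlow hd.le).trans (hmain.trans (by gcongr))
  have h6 : d * (X.ncard * (A.ncard * β) ^ 2) * n ^ 2 =
      d * (A.ncard * B.ncard * X.ncard) * (A.ncard * B.ncard) := by
    rw [hβ]; field_simp
  have h7 : d * (A.ncard * B.ncard * X.ncard) * (A.ncard * B.ncard) ≤
      n ^ 3 * (A.ncard * B.ncard : ℝ) := by
    rw [← h6]
    calc _ ≤ n * A.ncard * B.ncard * n ^ 2 := by gcongr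
      _ = _ := by ring
  exact le_of_mul_le_mul_right h7 (by positivity)

end gowers

/-! ### Closing the cycle of implications -/

theorem HasLargeDeficientTriple.not_isQuasirandom {G : Type*} [Group G] [Finite G] {c d : ℝ}
    (hc : 0 < c) (h : HasLargeDeficientTriple G c) (hd : 1 < d * c ^ 3) :
    ¬ IsQuasirandom G d := by
  intro hG
  have := Fintype.ofFinite G
  obtain ⟨A, B, C, hA, hB, hC, hne⟩ := h
  obtain ⟨g, hg⟩ := (Set.ne_univ_iff_exists_notMem _).1 hne
  have hn : (0 : ℝ) < Nat.card G := by exact_mod_cast Nat.card_pos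
  have hne : ∀ S : Set G, c * (Nat.card G : ℝ) ≤ S.ncard → S.Nonempty := fun S hS ↦ by
    rw [← Set.ncard_pos]
    exact_mod_cast (mul_pos hc hn).trans_le hS
  have hX : (g • C⁻¹).ncard = C.ncard := by rw [Set.ncard_smul_set, Set.ncard_inv]
  -- If `ab = gz⁻¹` with `z ∈ C`, then `g = abz` would lie in `ABC`.
  have hdisj : Disjoint (A * B) (g • C⁻¹) := by
    refine Set.disjoint_left.2 ?_
    rintro x hx ⟨z, hz, rfl⟩
    exact hg ⟨_, hx, z⁻¹, hz, by simp⟩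
  have hle := hG.mul_ncard_le_of_disjoint (hne A hA) (hne B hB) hdisj
  rw [hX] at hle
  have hd0 : 0 < d := pos_of_mul_pos_left (zero_lt_one.trans hd) (by positivity)
  have : d * (c * Nat.card G * (c * Nat.card G) * (c * Nat.card G)) ≤
      d * (A.ncard * B.ncard * C.ncard) := by gcongr
  have h1 : d * (c * Nat.card G * (c * Nat.card G) * (c * Nat.card G)) =
      d * c ^ 3 * (Nat.card G : ℝ) ^ 3 := by ring
  have h2 : (1 : ℝ) * (Nat.card G : ℝ) ^ 3 < d * c ^ 3 * (Nat.card G : ℝ) ^ 3 := by gcongr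
  linarith

theorem exists_hasLargeProductFree_of_not_isQuasirandom (d : ℝ) :
    ∃ c : ℝ, 0 < c ∧ ∀ (G : Type*) [Group G] [Finite G],
      ¬ IsQuasirandom G d → HasLargeProductFree G c := by
  obtain ⟨c, hc, -, h⟩ := exists_hasSmallIndexNonPerfect_of_not_isQuasirandom d
  exact ⟨c / 4, by positivity, fun G _ _ hG ↦ (h G hG).hasLargeProductFree hc⟩

/-- The numerator 2 provides the strict inequality needed to contradict quasirandomness; any number
above 1 would do. -/
theorem one_lt_two_div_pow_mul {c : ℝ} (hc : 0 < c) : 1 < 2 / c ^ 3 * c ^ 3 := by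
  rw [div_mul_cancel₀ _ (by positivity)]
  norm_num

theorem mainTheorem2 :
    ∀ c : ℝ, 0 < c → ∃ c₁ c₂ c₃ c₄ : ℝ,
      (0 < c₁ ∧ c₁ ≤ 1) ∧ (0 < c₂ ∧ c₂ ≤ 1) ∧ (0 < c₃ ∧ c₃ ≤ 1) ∧ (0 < c₄ ∧ c₄ ≤ 1) ∧
      ∀ (G : Type*) [Group G] [Finite G],
        (HasLargeProductFree G c ∨ HasLargeDeficientTriple G c ∨
          HasSmallIndexNonPerfect G c ∨ ¬ IsQuasirandom G (1 / c)) →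
        (HasLargeProductFree G c₁ ∧ HasLargeDeficientTriple G c₂ ∧
          HasSmallIndexNonPerfect G c₃ ∧ ¬ IsQuasirandom G (1 / c₄)) := by
  intro c hc
  obtain ⟨b, hb0, hb⟩ := exists_hasLargeProductFree_of_not_isQuasirandom (2 / c ^ 3)
  obtain ⟨b', hb'0, hb'⟩ := exists_hasLargeProductFree_of_not_isQuasirandom (1 / c)
  -- Each of the four hypotheses yields (a) with one of `c`, `b`, `c / 4`, `b'`; the minimum serves
  -- them all, and one turn of the cycle from (a) gives the rest.
  let a := min (min 1 (c / 4)) (min b b')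
  have ha0 : 0 < a := by positivity
  have ha1 : a ≤ 1 := (min_le_left _ _).trans (min_le_left _ _)
  have hac : a ≤ c / 4 := (min_le_left _ _).trans (min_le_right _ _)
  have hab : a ≤ b := (min_le_right _ _).trans (min_le_left _ _)
  have hab' : a ≤ b' := (min_le_right _ _).trans (min_le_right _ _)
  obtain ⟨e, he0, he1, he⟩ := exists_hasSmallIndexNonPerfect_of_not_isQuasirandom (2 / a ^ 3)
  refine ⟨a, a, e, a ^ 3 / 2, ⟨ha0, ha1⟩, ⟨ha0, ha1⟩, ⟨he0, he1⟩, ⟨by positivity, ?_⟩, ?_⟩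
  · have : a ^ 3 ≤ 1 := pow_le_one₀ ha0.le ha1
    linarith
  intro G _ _ h
  have hA : HasLargeProductFree G a := by
    rcases h with h | h | h | h
    · exact h.mono (by linarith)
    · exact (hb G (h.not_isQuasirandom hc (one_lt_two_div_pow_mul hc))).mono hab
    · exact (h.hasLargeProductFree hc).mono hac
    · exact (hb' G h).mono hab'
  have hB := hA.hasLargeDeficientTriple
  have hD := hB.not_isQuasirandom ha0 (one_lt_two_div_pow_mul ha0)
  exact ⟨hA, hB, he G hD, by rwa [one_div_div]⟩
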